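/- Let $d\ge 0$ and let $\alpha=(\alpha_1,\dots,\alpha_{d+1})\in\mathbb R^{d+1}$ be strictly increasing, i.e. $\alpha_1<\alpha_2<\dots<\alpha_{d+1}$. Put $U_d^\alpha=\{x\in\mathbb R^{d+1} : \sum_i x_i=\sum_i\alpha_i\}$, and let $$\mathrm{Perm}(\alpha)=\mathrm{ConvexHull}\{(\alpha_{\pi(1)},\dots,\alpha_{\pi(d+1)}) : \pi\in\mathfrak S_{d+1}\}\subseteq U_d^\alpha$$ be the usual permutohedron. For a complete binary tree $T$ (a plane rooted tree in which every internal vertex has exactly two children, Left and Right) with $t$ internal vertices, whose Left and Right subtrees at the root have $a$ and $b$ internal vertices, put $\mathrm{val}(\alpha,T)=\sum_{k=1}^{t}\alpha_k-\sum_{k=1}^{a}\alpha_k-\sum_{k=1}^{b}\alpha_k$. If $T$ has $d+1$ internal vertices, hence $d+2$ leaves $\ell_1,\dots,\ell_{d+2}$ from left to right, let $T_{(i)}$ be the subtree of $T$ rooted at the closest common ancestor of $\ell_i$ and $\ell_{i+1}$, and let $v^\alpha_T=(\mathrm{val}(\alpha,T_{(1)}),\dots,\mathrm{val}(\alpha,T_{(d+1)}))$.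 The Loday associahedron is $$\mathrm{LodAsso}(\alpha)=\mathrm{ConvexHull}\{v^\alpha_T : T \text{ a complete binary tree with } d+1 \text{ internal vertices}\}.$$ A finite system of inequalities $\langle a_i,x\rangle\le b_i$, $i\in I$, is a minimal inequality description of a polytope $P\subseteq U_d^\alpha$ if $P=\{x\in U_d^\alpha : \langle a_i,x\rangle\le b_i \text{ for all } i\in I\}$ and $i\mapsto\{x\in P : \langle a_i,x\rangle=b_i\}$ is a bijection from $I$ onto the set of facets of $P$ (nonempty faces of dimension $\dim P-1$). A polytope $Q$ is called an $\alpha$-removohedron if there are a minimal inequality description of $\mathrm{Perm}(\alpha)$, indexed by a set $I$, and a subset $J\subseteq I$ such that $$Q=\{x\in U_d^\alpha : \langle a_j,x\rangle\le b_j \text{ for all } j\in J\}.$$ Then $\mathrm{LodAsso}(\alpha)$ is an $\alpha$-removohedron; that is, it is defined in $U_d^\alpha$ by a subset of the facet inequalities of $\mathrm{Perm}(\alpha)$. -/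

import Mathlib

/-! Vectors of `ℝ ^ (d + 1)` are functions `Fin (d + 1) → ℝ`, the pairing is the dot product `⬝ᵥ`,
and indices start at `0`: the entry `α_{k+1}` of a sequence `(α_1, …, α_{d+1})` is `α k`.

Complete binary trees (plane rooted trees whose internal vertices all have exactly two children)
are the terms of `BinaryTree Unit`: `nil` is the tree whose only vertex is a leaf, and `node () l r`
has a root with Left subtree `l` and Right subtree `r`. The number of internal vertices is
`BinaryTree.numNodes`, the number of leaves is `BinaryTree.numLeaves`. -/

namespace LodayAssociahedron

open scoped Matrix

/-- The affine hyperplane `U_d^α` of vectors with the same coordinate sum as `α`. -/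
def affU {d : ℕ} (α : Fin (d + 1) → ℝ) : Set (Fin (d + 1) → ℝ) :=
  {x | ∑ i, x i = ∑ i, α i}

/-- The usual permutohedron: the convex hull of all `(α_{π(1)}, …, α_{π(d+1)})`. -/
def permutohedron {d : ℕ} (α : Fin (d + 1) → ℝ) : Set (Fin (d + 1) → ℝ) :=
  convexHull ℝ (Set.range fun π : Equiv.Perm (Fin (d + 1)) => fun i => α (π i))

/-- The subtree of `T` rooted at the closest common ancestor of the leaves number `i` and `j`,
the leaves being numbered `0, 1, 2, …` from left to right. -/
def subtreeAtClosestCommonAncestor : BinaryTree Unit → ℕ → ℕ → BinaryTree Unit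
  | .nil, _, _ => .nil
  | .node u l r, i, j =>
    if i < l.numLeaves ∧ j < l.numLeaves then
      subtreeAtClosestCommonAncestor l i j
    else if l.numLeaves ≤ i ∧ l.numLeaves ≤ j then
      subtreeAtClosestCommonAncestor r (i - l.numLeaves) (j - l.numLeaves)
    else
      .node u l r

/-- The internal vertex with label `i` is the closest common ancestor of the two consecutive leaves
number `i` and `i + 1`; this is the subtree `T_(i)` rooted at it. -/
def subtreeAtLabel (T : BinaryTree Unit) (i : ℕ) : BinaryTree Unit :=
  subtreeAtClosestCommonAncestor T i (i + 1)

/-- The sum of the first `t` entries of `α`. -/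
def prefixSum {d : ℕ} (α : Fin (d + 1) → ℝ) (t : ℕ) : ℝ :=
  ∑ k : Fin (d + 1) with k.val < t, α k

/-- `val(α, T)`, from the numbers of internal vertices of `T` and of its Left and Right subtree. -/
def treeVal {d : ℕ} (α : Fin (d + 1) → ℝ) (T : BinaryTree Unit) : ℝ :=
  prefixSum α T.numNodes - prefixSum α T.left.numNodes - prefixSum α T.right.numNodes

/-- The point `v^α_T`, whose coordinate number `i` is `val(α, T_(i))`. -/
def lodayVertex {d : ℕ} (α : Fin (d + 1) → ℝ) (T : BinaryTree Unit) : Fin (d + 1) → ℝ :=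
  fun i => treeVal α (subtreeAtLabel T i)

/-- The Loday associahedron: the convex hull of the points `v^α_T`, where `T` runs over the
complete binary trees with `d + 1` internal vertices. -/
def lodAsso {d : ℕ} (α : Fin (d + 1) → ℝ) : Set (Fin (d + 1) → ℝ) :=
  convexHull ℝ {v | ∃ T : BinaryTree Unit, T.numNodes = d + 1 ∧ v = lodayVertex α T}

/-- `F` is the face of `P` on which the linear functional `⟨w, ·⟩` is maximal, for some `w`. -/
def IsFace {n : ℕ} (P F : Set (Fin n → ℝ)) : Prop :=
  ∃ w : Fin n → ℝ, F = {x | x ∈ P ∧ ∀ y ∈ P, w ⬝ᵥ y ≤ w ⬝ᵥ x}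

/-- The dimension of the affine span, for a nonempty set. -/
noncomputable def dimension {n : ℕ} (P : Set (Fin n → ℝ)) : ℕ :=
  Module.finrank ℝ (affineSpan ℝ P).direction

/-- A facet is a nonempty face whose dimension is one less than that of `P`. -/
def IsFacet {n : ℕ} (P F : Set (Fin n → ℝ)) : Prop :=
  F.Nonempty ∧ IsFace P F ∧ dimension F + 1 = dimension P

/-- The part of `U` that is cut out by the inequalities `⟨a, x⟩ ≤ b`, for `(a, b)` in `I`. -/
def solutionSet {n : ℕ} (U : Set (Fin n → ℝ)) (I : Finset ((Fin n → ℝ) × ℝ)) :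
    Set (Fin n → ℝ) :=
  {x | x ∈ U ∧ ∀ q ∈ I, q.1 ⬝ᵥ x ≤ q.2}

/-- The finite system `I` of inequalities `⟨a, x⟩ ≤ b` is a minimal inequality description of `P`
in `U`: it defines `P`, every inequality is facet-defining (its equality case is a facet of `P`),
and every facet of `P` comes from exactly one inequality of the system. -/
def IsMinimalDescription {n : ℕ} (U P : Set (Fin n → ℝ)) (I : Finset ((Fin n → ℝ) × ℝ)) : Prop :=
  P = solutionSet U I ∧
    Set.BijOn (fun q : (Fin n → ℝ) × ℝ => {x | x ∈ P ∧ q.1 ⬝ᵥ x = q.2}) ↑I {F | IsFacet P F}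

/-- `Q` is an `α`-removohedron: a polytope in `U_d^α` that is defined by a subset `J` of a system
`I` of facet inequalities that defines the permutohedron of `α`. -/
def IsRemovohedron {d : ℕ} (α : Fin (d + 1) → ℝ) (Q : Set (Fin (d + 1) → ℝ)) : Prop :=
  Bornology.IsBounded Q ∧
    ∃ I J : Finset ((Fin (d + 1) → ℝ) × ℝ),
      IsMinimalDescription (affU α) (permutohedron α) I ∧ J ⊆ I ∧ Q = solutionSet (affU α) J

end LodayAssociahedron

namespace LodayAssociahedron

open scoped Matrix

/-! Write `f k` for the sum of the `k` smallest entries of `α`. Inside `affU α`, both polytopes are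
cut out by inequalities `f |S| ≤ ∑ i ∈ S, x i`: the permutohedron by those of all `S`
(`mem_permutohedron_iff`), the associahedron by those of intervals `S` (`mem_lodAsso_iff`). In both
cases the vertices satisfy the inequalities, and for each weight `w` some vertex maximizes `w` over
all solutions, so by separation every solution lies in the hull. For the permutohedron that vertex
is sorted like `w`; for the associahedron it comes from the tree with the greatest weight at each
root. Convexity of `f` gives validity for trees. The nonempty proper `S` correspond bijectively to
the facets of the permutohedron (`isMinimalDescription_permutohedron`), so keeping only the
intervals removes facet inequalities. -/

theorem mem_convexHull_of_forall_exists_dotProduct_le {n : ℕ} {S : Set (Fin n → ℝ)}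
    (hS : S.Finite) {x : Fin n → ℝ} (h : ∀ w : Fin n → ℝ, ∃ v ∈ S, w ⬝ᵥ x ≤ w ⬝ᵥ v) :
    x ∈ convexHull ℝ S := by
  by_contra hx
  obtain ⟨f, u, hf, hu⟩ := geometric_hahn_banach_closed_point (convex_convexHull ℝ S)
    (hS.isClosed_convexHull ℝ) hx
  have key : ∀ y : Fin n → ℝ, f y = (fun i => f (Pi.single i 1)) ⬝ᵥ y := by
    intro y
    conv_lhs => rw [pi_eq_sum_univ' y]
    simp [dotProduct, mul_comm]
  obtain ⟨v, hv, hle⟩ := h fun i => f (Pi.single i 1)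
  rw [← key, ← key] at hle
  linarith [hf v (subset_convexHull ℝ S hv)]

/-! ### Convexity of the prefix sums. -/

section PrefixSum

variable {d : ℕ} (α : Fin (d + 1) → ℝ)

@[simp]
theorem prefixSum_zero : prefixSum α 0 = 0 := by simp [prefixSum]

theorem prefixSum_top : prefixSum α (d + 1) = ∑ i, α i := by
  rw [prefixSum, Finset.filter_true_of_mem fun i _ => i.isLt]

theorem prefixSum_succ {k : ℕ} (hk : k < d + 1) :
    prefixSum α (k + 1) = prefixSum α k + α ⟨k, hk⟩ := by
  have : ({i : Fin (d + 1) | i.val < k + 1} : Finset (Fin (d + 1))) =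
      insert ⟨k, hk⟩ ({i : Fin (d + 1) | i.val < k} : Finset (Fin (d + 1))) := by
    ext i
    simp only [Finset.mem_filter, Finset.mem_univ, true_and, Finset.mem_insert, Fin.ext_iff]
    omega
  rw [prefixSum, this, Finset.sum_insert (by simp), add_comm, prefixSum]

variable {α}

/-- Convexity: the increments of `prefixSum α` are the entries of `α`, which increase. -/
theorem prefixSum_shift_le (hα : Monotone α) {a b : ℕ} (hab : a ≤ b) (c : ℕ)
    (hb : b + c ≤ d + 1) :
    prefixSum α (a + c) - prefixSum α a ≤ prefixSum α (b + c) - prefixSum α b := by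
  induction c with
  | zero => simp
  | succ c ih =>
    rw [← add_assoc, ← add_assoc, prefixSum_succ α (by omega : a + c < d + 1),
      prefixSum_succ α (by omega : b + c < d + 1)]
    have := hα (show (⟨a + c, by omega⟩ : Fin (d + 1)) ≤ ⟨b + c, by omega⟩ from
      Fin.mk_le_mk.2 (by omega))
    linarith [ih (by omega)]

/-- The defect of superadditivity of `prefixSum` is monotone in both sizes. -/
theorem prefixSum_defect_mono (hα : Monotone α) {a b a' b' : ℕ} (ha : a' ≤ a) (hb : b' ≤ b)
    (h : a + b + 1 ≤ d + 1) :
    prefixSum α (a' + b' + 1) - prefixSum α a' - prefixSum α b' ≤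
      prefixSum α (a + b + 1) - prefixSum α a - prefixSum α b := by
  -- Enlarge `a'` to `a` first, then `b'` to `b`; the value at `a + b' + 1` cancels.
  have h1 := prefixSum_shift_le hα ha (b' + 1) (by omega)
  have h2 := prefixSum_shift_le hα hb (a + 1) (by omega)
  rw [show b' + (a + 1) = a + (b' + 1) by ring, show b + (a + 1) = a + b + 1 by ring] at h2
  rw [← add_assoc] at h1
  linarith

end PrefixSum

/-! ### Coordinates of tree vectors and the greedy tree. -/

section TreeCoordinates

variable {d : ℕ} (α : Fin (d + 1) → ℝ)

/-- The coordinate number `i` of `v^α_T`, for a tree with any number of internal vertices. -/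
noncomputable def treeCoord (T : BinaryTree Unit) (i : ℕ) : ℝ :=
  treeVal α (subtreeAtLabel T i)

/-- `l` has one more leaf than internal vertices, so leaves `i` and `i + 1` both lie in `l` iff `i <
l.numNodes`, and they straddle the root iff `i = l.numNodes`. -/
theorem treeCoord_left (l r : BinaryTree Unit) {i : ℕ} (hi : i < l.numNodes) :
    treeCoord α (.node () l r) i = treeCoord α l i := by
  have := l.numLeaves_eq_numNodes_succ
  rw [treeCoord, subtreeAtLabel, subtreeAtClosestCommonAncestor, if_pos (by omega)]
  rfl

theorem treeCoord_root (l r : BinaryTree Unit) :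
    treeCoord α (.node () l r) l.numNodes =
      prefixSum α (l.numNodes + r.numNodes + 1) - prefixSum α l.numNodes -
        prefixSum α r.numNodes := by
  have := l.numLeaves_eq_numNodes_succ
  rw [treeCoord, subtreeAtLabel, subtreeAtClosestCommonAncestor, if_neg (by omega),
    if_neg (by omega)]
  rfl

theorem treeCoord_right (l r : BinaryTree Unit) (i : ℕ) :
    treeCoord α (.node () l r) (l.numNodes + 1 + i) = treeCoord α r i := by
  have := l.numLeaves_eq_numNodes_succ
  rw [treeCoord, subtreeAtLabel, subtreeAtClosestCommonAncestor, if_neg (by omega),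
    if_pos (by omega), show l.numNodes + 1 + i - l.numLeaves = i by omega,
    show l.numNodes + 1 + i + 1 - l.numLeaves = i + 1 by omega]
  rfl

theorem sum_Ico_treeCoord_left (l r : BinaryTree Unit) {p q : ℕ} (hq : q ≤ l.numNodes)
    (c : ℕ → ℝ) :
    ∑ i ∈ Finset.Ico p q, c i * treeCoord α (.node () l r) i =
      ∑ i ∈ Finset.Ico p q, c i * treeCoord α l i :=
  Finset.sum_congr rfl fun i hi => by
    rw [treeCoord_left α l r ((Finset.mem_Ico.1 hi).2.trans_le hq)]

theorem sum_Ico_treeCoord_right (l r : BinaryTree Unit) (p q : ℕ) (c : ℕ → ℝ) :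
    ∑ i ∈ Finset.Ico (l.numNodes + 1 + p) (l.numNodes + 1 + q),
        c i * treeCoord α (.node () l r) i =
      ∑ i ∈ Finset.Ico p q, c (l.numNodes + 1 + i) * treeCoord α r i := by
  rw [add_comm _ p, add_comm _ q, ← Finset.sum_Ico_add']
  exact Finset.sum_congr rfl fun i _ => by
    rw [add_comm i, treeCoord_right]

theorem sum_Ico_split (g : ℕ → ℝ) {p a q : ℕ} (hp : p ≤ a) (hq : a < q) :
    ∑ i ∈ Finset.Ico p q, g i =
      ∑ i ∈ Finset.Ico p a, g i + g a + ∑ i ∈ Finset.Ico (a + 1) q, g i := by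
  rw [← Finset.sum_Ico_consecutive g hp hq.le, Finset.sum_eq_sum_Ico_succ_bot hq, add_assoc]

/-- Weights `c = 1` serve the interval sums, general `c` the linear functionals. -/
theorem sum_Ico_treeCoord_split (l r : BinaryTree Unit) {p q : ℕ} (hp : p ≤ l.numNodes)
    (c : ℕ → ℝ) :
    ∑ i ∈ Finset.Ico p (l.numNodes + 1 + q), c i * treeCoord α (.node () l r) i =
      ∑ i ∈ Finset.Ico p l.numNodes, c i * treeCoord α l i +
        c l.numNodes * (prefixSum α (l.numNodes + r.numNodes + 1) - prefixSum α l.numNodes -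
          prefixSum α r.numNodes) +
        ∑ i ∈ Finset.Ico 0 q, c (l.numNodes + 1 + i) * treeCoord α r i := by
  rw [sum_Ico_split _ hp (by omega), sum_Ico_treeCoord_left α l r le_rfl, treeCoord_root,
    ← sum_Ico_treeCoord_right]

theorem sum_treeCoord (T : BinaryTree Unit) :
    ∑ i ∈ Finset.Ico 0 T.numNodes, treeCoord α T i = prefixSum α T.numNodes := by
  induction T with
  | nil => simp
  | node u l r hl hr =>
    have := sum_Ico_treeCoord_split α l r (p := 0) (q := r.numNodes) (Nat.zero_le _) 1
    simp only [Pi.one_apply, one_mul] at this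
    rw [BinaryTree.numNodes, show l.numNodes + r.numNodes + 1 = l.numNodes + 1 + r.numNodes by ring,
      this, hl, hr]
    ring_nf

variable {α}

/-- An interval avoiding the root label lies in one subtree. Otherwise it is a final segment of `l`,
the root and an initial segment of `r`; the root coordinate is the defect at the full sizes, hence
at least the defect at the segment lengths. -/
theorem prefixSum_le_sum_treeCoord (hα : Monotone α) (T : BinaryTree Unit)
    (hT : T.numNodes ≤ d + 1) {p q : ℕ} (hpq : p ≤ q) (hq : q ≤ T.numNodes) :
    prefixSum α (q - p) ≤ ∑ i ∈ Finset.Ico p q, treeCoord α T i := by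
  induction T generalizing p q with
  | nil =>
    obtain rfl : q = 0 := by simpa using hq
    simp
  | node u l r hl hr =>
    rw [BinaryTree.numNodes] at hT hq
    rcases le_or_gt q l.numNodes with h | h
    · have := sum_Ico_treeCoord_left α l r (p := p) h 1
      simp only [Pi.one_apply, one_mul] at this
      rw [this]
      exact hl (by omega) hpq h
    obtain ⟨q, rfl⟩ := Nat.exists_eq_add_of_le (Nat.succ_le_of_lt h)
    rw [Nat.succ_eq_add_one] at *
    rcases le_or_gt p l.numNodes with h' | h'
    · have := sum_Ico_treeCoord_split α l r (q := q) h' 1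
      simp only [Pi.one_apply, one_mul] at this
      rw [this]
      have h1 := hl (by omega) h' le_rfl
      have h2 := hr (by omega) (Nat.zero_le q) (by omega)
      have h3 := prefixSum_defect_mono hα (Nat.sub_le l.numNodes p)
        (show q ≤ r.numNodes by omega) hT
      rw [show l.numNodes - p + q + 1 = l.numNodes + 1 + q - p by omega] at h3
      rw [Nat.sub_zero] at h2
      linarith
    · obtain ⟨p, rfl⟩ := Nat.exists_eq_add_of_le (Nat.succ_le_of_lt h')
      rw [Nat.succ_eq_add_one] at *
      have := sum_Ico_treeCoord_right α l r p q 1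
      simp only [Pi.one_apply, one_mul] at this
      rw [this, show l.numNodes + 1 + q - (l.numNodes + 1 + p) = q - p by omega]
      exact hr (by omega) (by omega) (by omega)

variable (α)

/-- For weights `w` on an interval, the tree built by choosing the position of the greatest weight
as root maximizes `w` over the solutions of all interval inequalities. -/
theorem exists_tree_forall_sum_le (w : ℕ → ℝ) (t s : ℕ) :
    ∃ T : BinaryTree Unit, T.numNodes = t ∧ ∀ x : ℕ → ℝ,
      (∀ p q, s ≤ p → p ≤ q → q ≤ s + t → prefixSum α (q - p) ≤ ∑ i ∈ Finset.Ico p q, x i) →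
      ∀ c, (∀ i ∈ Finset.Ico s (s + t), w i ≤ c) →
        ∑ i ∈ Finset.Ico s (s + t), w i * x i ≤
          ∑ i ∈ Finset.Ico 0 t, w (s + i) * treeCoord α T i +
            c * (∑ i ∈ Finset.Ico s (s + t), x i - prefixSum α t) := by
  induction t using Nat.strong_induction_on generalizing s with
  | _ t ih =>
    rcases Nat.eq_zero_or_pos t with rfl | ht
    · exact ⟨.nil, rfl, by simp⟩
    -- The root depends on `w` alone, so one tree serves every `x`.
    obtain ⟨k, hk, hmax⟩ := Finset.exists_max_image (Finset.Ico s (s + t)) w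
      ⟨s, Finset.mem_Ico.2 ⟨le_rfl, by omega⟩⟩
    rw [Finset.mem_Ico] at hk
    obtain ⟨a, rfl⟩ := Nat.exists_eq_add_of_le hk.1
    obtain ⟨b, rfl⟩ := Nat.exists_eq_add_of_le (show a + 1 ≤ t by omega)
    obtain ⟨l, rfl, hl⟩ := ih a (by omega) s
    obtain ⟨r, rfl, hr⟩ := ih b (by omega) (s + (l.numNodes + 1))
    refine ⟨.node () l r, by rw [BinaryTree.numNodes]; ring, fun x hx c hc => ?_⟩
    -- On a subinterval `x` may exceed its bound; taking the root weight as `c` there lets both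
    -- excesses merge with the root term into the excess of the whole interval.
    have h1 := hl x (fun p q hp hpq hq => hx p q hp hpq (by omega)) (w (s + l.numNodes))
      (fun i hi => hmax i (by rw [Finset.mem_Ico] at *; omega))
    have h2 := hr x (fun p q hp hpq hq => hx p q (by omega) hpq (by omega)) (w (s + l.numNodes))
      (fun i hi => hmax i (by rw [Finset.mem_Ico] at *; omega))
    have h3 := sum_Ico_treeCoord_split α l r (q := r.numNodes) (Nat.zero_le _)
      (fun i => w (s + i))
    have h4 := hx s (s + (l.numNodes + 1 + r.numNodes)) le_rfl (by omega) le_rfl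
    rw [Nat.add_sub_cancel_left] at h4
    -- The total excess is nonnegative, so its factor may grow from the root weight to `c`.
    have h5 := mul_le_mul_of_nonneg_right (hc (s + l.numNodes) (by rw [Finset.mem_Ico]; omega))
      (sub_nonneg.2 h4)
    refine le_trans ?_ (add_le_add le_rfl h5)
    rw [h3, sum_Ico_split _ (show s ≤ s + l.numNodes by omega) (by omega),
      sum_Ico_split x (show s ≤ s + l.numNodes by omega) (by omega)]
    simp only [← add_assoc] at h1 h2 ⊢
    rw [show l.numNodes + 1 + r.numNodes = l.numNodes + r.numNodes + 1 by ring]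
    linarith

end TreeCoordinates

/-! ### The associahedron by interval inequalities. -/

section LodAsso

variable {d : ℕ} {α : Fin (d + 1) → ℝ}

/-- The labels `i` with `p ≤ i < q`. -/
def labelInterval (d p q : ℕ) : Finset (Fin (d + 1)) :=
  {i : Fin (d + 1) | p ≤ i.val ∧ i.val < q}

theorem sum_labelInterval (g : ℕ → ℝ) {p q : ℕ} (hq : q ≤ d + 1) :
    ∑ i ∈ labelInterval d p q, g i = ∑ i ∈ Finset.Ico p q, g i := by
  rw [labelInterval, Finset.sum_filter,
    Fin.sum_univ_eq_sum_range (fun i => if p ≤ i ∧ i < q then g i else 0) (d + 1),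
    ← Finset.sum_filter]
  congr 1
  ext i
  simp only [Finset.mem_filter, Finset.mem_range, Finset.mem_Ico]
  omega

theorem card_labelInterval {p q : ℕ} (hq : q ≤ d + 1) : (labelInterval d p q).card = q - p := by
  have := sum_labelInterval (d := d) (p := p) (fun _ => 1) hq
  simp only [Finset.sum_const, nsmul_eq_mul, mul_one, Nat.card_Ico] at this
  exact_mod_cast this

theorem labelInterval_univ : labelInterval d 0 (d + 1) = Finset.univ := by
  exact Finset.filter_true_of_mem fun i _ => ⟨Nat.zero_le _, i.isLt⟩

theorem finite_lodayVertices (α : Fin (d + 1) → ℝ) :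
    {v | ∃ T : BinaryTree Unit, T.numNodes = d + 1 ∧ v = lodayVertex α T}.Finite := by
  refine ((BinaryTree.treesOfNumNodesEq (d + 1)).finite_toSet.image (lodayVertex α)).subset ?_
  rintro _ ⟨T, hT, rfl⟩
  exact ⟨T, Finset.mem_coe.2 (BinaryTree.mem_treesOfNumNodesEq.2 hT), rfl⟩

/-- The Loday associahedron is cut out by the interval inequalities. -/
theorem mem_lodAsso_iff (hα : Monotone α) {x : Fin (d + 1) → ℝ} :
    x ∈ lodAsso α ↔ x ∈ affU α ∧ ∀ p q, p ≤ q → q ≤ d + 1 →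
      prefixSum α (labelInterval d p q).card ≤ ∑ i ∈ labelInterval d p q, x i := by
  constructor
  · intro hx
    let C : Set (Fin (d + 1) → ℝ) := {x | x ∈ affU α ∧ ∀ p q, p ≤ q → q ≤ d + 1 →
      prefixSum α (labelInterval d p q).card ≤ ∑ i ∈ labelInterval d p q, x i}
    have hC : Convex ℝ C := by
      rintro y ⟨hy, hy'⟩ z ⟨hz, hz'⟩ a b ha hb hab
      refine ⟨?_, fun p q hpq hq => ?_⟩
      · simp only [affU, Set.mem_ofPred_eq] at hy hz ⊢
        simp [Finset.sum_add_distrib, ← Finset.mul_sum, hy, hz, ← add_mul, hab]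
      · simp only [Pi.add_apply, Pi.smul_apply, smul_eq_mul, Finset.sum_add_distrib,
          ← Finset.mul_sum]
        have h1 := mul_le_mul_of_nonneg_left (hy' p q hpq hq) ha
        have h2 := mul_le_mul_of_nonneg_left (hz' p q hpq hq) hb
        have h3 : a * prefixSum α (labelInterval d p q).card +
          b * prefixSum α (labelInterval d p q).card = prefixSum α (labelInterval d p q).card := by
          rw [← add_mul, hab, one_mul]
        linarith
    refine convexHull_min (s := _) (t := C) ?_ hC hx
    rintro _ ⟨T, hT, rfl⟩
    have hcoord : ∀ p q, q ≤ d + 1 → ∑ i ∈ labelInterval d p q, lodayVertex α T i =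
        ∑ i ∈ Finset.Ico p q, treeCoord α T i :=
      fun p q hq => sum_labelInterval (treeCoord α T) hq
    refine ⟨?_, fun p q hpq hq => ?_⟩
    · have := sum_treeCoord α T
      rwa [hT, prefixSum_top, ← hcoord 0 _ le_rfl, labelInterval_univ] at this
    · rw [card_labelInterval hq, hcoord p q hq]
      exact prefixSum_le_sum_treeCoord hα T hT.le hpq (hT ▸ hq)
  · rintro ⟨hU, hx⟩
    refine mem_convexHull_of_forall_exists_dotProduct_le (finite_lodayVertices α) fun w => ?_
    -- The default `0` is never read: all sums stay below `d + 1`.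
    let ext : (Fin (d + 1) → ℝ) → ℕ → ℝ := fun y k => if h : k < d + 1 then y ⟨k, h⟩ else 0
    have hext : ∀ y (i : Fin (d + 1)), ext y i = y i := fun y i => dif_pos i.isLt
    obtain ⟨T, hT, h⟩ := exists_tree_forall_sum_le α (ext w) (d + 1) 0
    refine ⟨_, ⟨T, hT, rfl⟩, ?_⟩
    obtain ⟨k, -, hk⟩ := Finset.exists_max_image (Finset.Ico 0 (0 + (d + 1))) (ext w)
      ⟨0, by simp⟩
    have hsum : ∀ p q, q ≤ d + 1 → ∑ i ∈ Finset.Ico p q, ext x i =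
        ∑ i ∈ labelInterval d p q, x i := fun p q hq => by
      rw [← sum_labelInterval _ hq]
      exact Finset.sum_congr rfl fun i _ => hext x i
    have key := h (ext x) (fun p q _ hpq hq => by
      rw [hsum p q (by omega), ← card_labelInterval (show q ≤ d + 1 by omega)]
      exact hx p q hpq (by omega)) _ hk
    have hdot : ∀ g : ℕ → ℝ, ∑ i ∈ Finset.Ico 0 (d + 1), ext w i * g i =
        ∑ i : Fin (d + 1), w i * g i := fun g => by
      rw [← sum_labelInterval _ le_rfl, labelInterval_univ]
      exact Finset.sum_congr rfl fun i _ => by rw [hext w i]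
    simp only [zero_add] at key
    -- Membership in `affU α` makes the total excess vanish.
    rw [hsum 0 (d + 1) le_rfl, labelInterval_univ, show ∑ i, x i = ∑ i, α i from hU,
      prefixSum_top, sub_self, mul_zero, add_zero, hdot, hdot] at key
    simp only [hext] at key
    exact key

end LodAsso

/-! ### Least sums over subsets of given size. -/

section SubsetSums

variable {d : ℕ} {α : Fin (d + 1) → ℝ}

/-- The least sum of `|A|` entries of `α` is attained only by the first `|A|` entries. -/
theorem prefixSum_card_lt (hα : StrictMono α) {A : Finset (Fin (d + 1))}
    (hA : A ≠ ({i : Fin (d + 1) | i.val < A.card} : Finset (Fin (d + 1)))) :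
    prefixSum α A.card < ∑ i ∈ A, α i := by
  set B : Finset (Fin (d + 1)) := {i : Fin (d + 1) | i.val < A.card} with hB
  have hAn : A.card ≤ d + 1 := by simpa using A.card_le_univ
  have hcard : B.card = A.card := by
    have := card_labelInterval (d := d) (p := 0) hAn
    simpa [labelInterval] using this
  have hdiff : (A \ B).card = (B \ A).card := by
    have h1 := Finset.card_sdiff_add_card_inter A B
    have h2 := Finset.card_sdiff_add_card_inter B A
    rw [Finset.inter_comm] at h2
    omega
  have hne : (B \ A).Nonempty := by
    rw [Finset.nonempty_iff_ne_empty, Ne, Finset.sdiff_eq_empty_iff_subset]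
    exact fun h => hA (Finset.eq_of_subset_of_card_le h hcard.ge).symm
  have hne' : (A \ B).Nonempty := by
    rw [← Finset.card_pos, hdiff]
    exact Finset.card_pos.2 hne
  obtain ⟨m, hm⟩ := hne'
  have hmem : ∀ i, i ∉ B → A.card ≤ i.val := fun i hi => by simpa [hB] using hi
  have hlt : A.card < d + 1 := (hmem m (Finset.mem_sdiff.1 hm).2).trans_lt m.isLt
  -- The entry at index `|A|` separates the two differences: it exceeds every entry on `B \ A` and
  -- is at most every entry on `A \ B`.
  have h1 : ∑ i ∈ B \ A, α i < (B \ A).card • α ⟨A.card, hlt⟩ := by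
    rw [← Finset.sum_const]
    refine Finset.sum_lt_sum_of_nonempty hne fun i hi => hα ?_
    have : i ∈ B := (Finset.mem_sdiff.1 hi).1
    rw [hB, Finset.mem_filter] at this
    exact this.2
  have h2 : (A \ B).card • α ⟨A.card, hlt⟩ ≤ ∑ i ∈ A \ B, α i :=
    Finset.card_nsmul_le_sum _ _ _ fun i hi => hα.monotone (hmem i (Finset.mem_sdiff.1 hi).2)
  have h3 := Finset.sum_inter_add_sum_sdiff A B α
  have h4 := Finset.sum_inter_add_sum_sdiff B A α
  rw [hdiff] at h2
  rw [Finset.inter_comm] at h4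
  change ∑ i ∈ B, α i < _
  linarith

theorem prefixSum_card_le (hα : StrictMono α) (A : Finset (Fin (d + 1))) :
    prefixSum α A.card ≤ ∑ i ∈ A, α i := by
  by_cases hA : A = ({i : Fin (d + 1) | i.val < A.card} : Finset (Fin (d + 1)))
  · conv_rhs => rw [hA]
    exact le_rfl
  · exact (prefixSum_card_lt hα hA).le

theorem sum_comp_perm (g : Fin (d + 1) → ℝ) (π : Equiv.Perm (Fin (d + 1)))
    (S : Finset (Fin (d + 1))) :
    ∑ i ∈ S, g (π i) = ∑ i ∈ S.map π.toEmbedding, g i := by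
  rw [Finset.sum_map]
  rfl

theorem prefixSum_le_sum_perm (hα : StrictMono α) (π : Equiv.Perm (Fin (d + 1)))
    (S : Finset (Fin (d + 1))) : prefixSum α S.card ≤ ∑ i ∈ S, α (π i) := by
  rw [sum_comp_perm, ← Finset.card_map π.toEmbedding]
  exact prefixSum_card_le hα _

/-- A permuted vector attains the bound of `S` exactly if its entries on `S` are the first ones. -/
theorem sum_perm_eq_iff (hα : StrictMono α) (π : Equiv.Perm (Fin (d + 1)))
    (S : Finset (Fin (d + 1))) :
    ∑ i ∈ S, α (π i) = prefixSum α S.card ↔ ∀ i, i ∈ S ↔ (π i).val < S.card := by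
  have hmem : (∀ i, i ∈ S ↔ (π i).val < S.card) ↔
      S.map π.toEmbedding = ({i : Fin (d + 1) | i.val < S.card} : Finset (Fin (d + 1))) := by
    rw [Finset.ext_iff]
    refine (forall_congr' fun i => ?_).trans (π.forall_congr_right (q := fun j =>
      j ∈ S.map π.toEmbedding ↔
        j ∈ ({i : Fin (d + 1) | i.val < S.card} : Finset (Fin (d + 1)))))
    simp
  rw [hmem, sum_comp_perm]
  constructor
  · intro h
    by_contra hne
    rw [← Finset.card_map π.toEmbedding] at hne h
    exact (prefixSum_card_lt hα hne).ne' h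
  · intro h
    rw [h, prefixSum]

theorem exists_perm_sum_eq (hα : StrictMono α) (S : Finset (Fin (d + 1))) :
    ∃ π : Equiv.Perm (Fin (d + 1)), ∑ i ∈ S, α (π i) = prefixSum α S.card := by
  have hcard : (labelInterval d 0 S.card).card = S.card :=
    card_labelInterval (by simpa using S.card_le_univ)
  let e := Finset.equivOfCardEq hcard.symm
  refine ⟨e.extendSubtype, (sum_perm_eq_iff hα _ S).2 fun i => ?_⟩
  have hL : ∀ j, j ∈ labelInterval d 0 S.card ↔ j.val < S.card := by simp [labelInterval]
  rw [← hL]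
  exact ⟨e.extendSubtype_mem i, fun h => by_contra fun hi => e.extendSubtype_not_mem i hi h⟩

end SubsetSums

/-! ### The permutohedron by subset inequalities. -/

section Permutohedron

variable {d : ℕ} {α : Fin (d + 1) → ℝ}

theorem perm_mem_permutohedron (α : Fin (d + 1) → ℝ) (π : Equiv.Perm (Fin (d + 1))) :
    (fun i => α (π i)) ∈ permutohedron α :=
  subset_convexHull ℝ _ ⟨π, rfl⟩

/-- Abel summation: increasing weights pair nonpositively with a vector whose prefix sums are
nonnegative, up to the total. -/
theorem sum_mul_le_of_prefix_nonneg (n : ℕ) (w y : Fin (n + 1) → ℝ) (hw : Monotone w)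
    (hy : ∀ k, 0 ≤ ∑ i : Fin (n + 1) with i.val < k, y i) :
    ∑ i, w i * y i ≤ w (Fin.last n) * ∑ i, y i := by
  induction n with
  | zero => simp
  | succ n ih =>
    have hpre : ∀ k, k ≤ n + 1 → ∑ i : Fin (n + 1) with i.val < k, y i.castSucc =
        ∑ i : Fin (n + 2) with i.val < k, y i := fun k hk => by
      rw [Finset.sum_filter, Finset.sum_filter, Fin.sum_univ_castSucc (n := n + 1)]
      simp [hk]
    have hpre' : ∀ k, 0 ≤ ∑ i : Fin (n + 1) with i.val < k, y i.castSucc := fun k => by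
      rcases le_total k (n + 1) with hk | hk
      · rw [hpre k hk]
        exact hy k
      · have h := hpre _ le_rfl
        rw [Finset.filter_true_of_mem fun i _ => i.isLt] at h
        rw [Finset.filter_true_of_mem fun i _ => i.isLt.trans_le hk, h]
        exact hy _
    have h := ih (fun i => w i.castSucc) (fun i => y i.castSucc)
      (fun i j hij => hw (Fin.castSucc_le_castSucc_iff.2 hij)) hpre'
    have h0 := hpre' (n + 1)
    rw [Finset.filter_true_of_mem fun i _ => i.isLt] at h0
    rw [Fin.sum_univ_castSucc, Fin.sum_univ_castSucc (f := y), mul_add]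
    -- The sum of all but the last entry is nonnegative, so its weight may be raised to the last
    -- one.
    have := mul_le_mul_of_nonneg_right (hw (Fin.le_last (Fin.last n).castSucc)) h0
    linarith

/-- A vertex of the permutohedron that is sorted like `w` maximizes `w` on the solutions of all
subset inequalities. -/
theorem dotProduct_le_of_monotone_comp {w x : Fin (d + 1) → ℝ} {σ : Equiv.Perm (Fin (d + 1))}
    (hw : Monotone (w ∘ σ)) (hU : x ∈ affU α)
    (hx : ∀ S : Finset (Fin (d + 1)), prefixSum α S.card ≤ ∑ i ∈ S, x i) :
    w ⬝ᵥ x ≤ w ⬝ᵥ fun i => α (σ.symm i) := by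
  -- In the order `σ`, the prefix sums of `x` minus the vertex are nonnegative by the inequalities
  -- of the sets `σ {0, …, k - 1}`, and the total is zero.
  have h := sum_mul_le_of_prefix_nonneg d (w ∘ σ) (fun j => x (σ j) - α j) hw fun k => by
    rw [Finset.sum_sub_distrib, sum_comp_perm, sub_nonneg]
    refine le_trans (le_of_eq ?_) (hx _)
    rw [Finset.card_map]
    rcases le_total k (d + 1) with hk | hk
    · have := card_labelInterval (d := d) (p := 0) hk
      simp only [labelInterval, Nat.zero_le, true_and, Nat.sub_zero] at this
      rw [this, prefixSum]
    · rw [Finset.filter_true_of_mem fun i _ => i.isLt.trans_le hk, Finset.card_univ,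
        Fintype.card_fin, prefixSum_top]
  have h0 : ∑ j, (x (σ j) - α j) = 0 := by
    rw [Finset.sum_sub_distrib, Equiv.sum_comp σ x, show ∑ i, x i = ∑ i, α i from hU, sub_self]
  rw [h0, mul_zero] at h
  simp only [Function.comp_apply, mul_sub, Finset.sum_sub_distrib, sub_nonpos] at h
  rw [Equiv.sum_comp σ fun i => w i * x i] at h
  refine h.trans (le_of_eq ?_)
  rw [dotProduct, ← Equiv.sum_comp σ fun i => w i * α (σ.symm i)]
  simp

/-- The permutohedron is cut out by the subset inequalities. -/
theorem mem_permutohedron_iff (hα : StrictMono α) {x : Fin (d + 1) → ℝ} :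
    x ∈ permutohedron α ↔ x ∈ affU α ∧
      ∀ S : Finset (Fin (d + 1)), prefixSum α S.card ≤ ∑ i ∈ S, x i := by
  constructor
  · intro hx
    let C : Set (Fin (d + 1) → ℝ) := {x | x ∈ affU α ∧
      ∀ S : Finset (Fin (d + 1)), prefixSum α S.card ≤ ∑ i ∈ S, x i}
    have hC : Convex ℝ C := by
      rintro y ⟨hy, hy'⟩ z ⟨hz, hz'⟩ a b ha hb hab
      refine ⟨?_, fun S => ?_⟩
      · simp only [affU, Set.mem_ofPred_eq] at hy hz ⊢
        simp [Finset.sum_add_distrib, ← Finset.mul_sum, hy, hz, ← add_mul, hab]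
      · simp only [Pi.add_apply, Pi.smul_apply, smul_eq_mul, Finset.sum_add_distrib,
          ← Finset.mul_sum]
        have h1 := mul_le_mul_of_nonneg_left (hy' S) ha
        have h2 := mul_le_mul_of_nonneg_left (hz' S) hb
        have h3 : a * prefixSum α S.card + b * prefixSum α S.card = prefixSum α S.card := by
          rw [← add_mul, hab, one_mul]
        linarith
    refine convexHull_min (t := C) ?_ hC hx
    rintro _ ⟨π, rfl⟩
    exact ⟨Equiv.sum_comp π α, prefixSum_le_sum_perm hα π⟩
  · rintro ⟨hU, hx⟩
    exact mem_convexHull_of_forall_exists_dotProduct_le (Set.finite_range _) fun w =>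
      ⟨_, ⟨(Tuple.sort w).symm, rfl⟩,
        dotProduct_le_of_monotone_comp (Tuple.monotone_sort w) hU hx⟩

end Permutohedron

/-! ### Facets of the permutohedron. -/

section Facets

variable {d : ℕ} {α : Fin (d + 1) → ℝ}

/-- The sum of the coordinates in `S`, as a linear functional. -/
def sumOn {n : ℕ} (S : Finset (Fin n)) : (Fin n → ℝ) →ₗ[ℝ] ℝ :=
  ∑ i ∈ S, LinearMap.proj i

@[simp]
theorem sumOn_apply {n : ℕ} (S : Finset (Fin n)) (x : Fin n → ℝ) : sumOn S x = ∑ i ∈ S, x i := by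
  simp [sumOn]

/-- The face of the permutohedron on which the coordinate sum over `S` is least. -/
def subsetFace (α : Fin (d + 1) → ℝ) (S : Finset (Fin (d + 1))) : Set (Fin (d + 1) → ℝ) :=
  {x | x ∈ permutohedron α ∧ ∑ i ∈ S, x i = prefixSum α S.card}

theorem perm_mem_subsetFace_iff (hα : StrictMono α) (π : Equiv.Perm (Fin (d + 1)))
    (S : Finset (Fin (d + 1))) :
    (fun i => α (π i)) ∈ subsetFace α S ↔ ∀ i, i ∈ S ↔ (π i).val < S.card := by
  rw [← sum_perm_eq_iff hα]
  exact and_iff_right (perm_mem_permutohedron α π)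

theorem exists_perm_mem_subsetFace (hα : StrictMono α) (S : Finset (Fin (d + 1))) :
    ∃ π : Equiv.Perm (Fin (d + 1)), (fun i => α (π i)) ∈ subsetFace α S := by
  obtain ⟨π, hπ⟩ := exists_perm_sum_eq hα S
  exact ⟨π, perm_mem_permutohedron α π, hπ⟩

theorem subsetFace_univ (hα : StrictMono α) : subsetFace α Finset.univ = permutohedron α := by
  ext x
  refine and_iff_left_of_imp fun hx => ?_
  rw [Finset.card_univ, Fintype.card_fin, prefixSum_top]
  exact ((mem_permutohedron_iff hα).1 hx).1

theorem swap_mem_subsetFace (hα : StrictMono α) {π : Equiv.Perm (Fin (d + 1))}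
    {S : Finset (Fin (d + 1))} (hπ : (fun i => α (π i)) ∈ subsetFace α S) {i j : Fin (d + 1)}
    (hij : i ∈ S ↔ j ∈ S) :
    (fun k => α (((Equiv.swap i j).trans π) k)) ∈ subsetFace α S := by
  rw [perm_mem_subsetFace_iff hα] at hπ ⊢
  intro k
  rw [Equiv.trans_apply, ← hπ]
  rcases eq_or_ne k i with rfl | hki
  · rw [Equiv.swap_apply_left, hij]
  rcases eq_or_ne k j with rfl | hkj
  · rw [Equiv.swap_apply_right, hij]
  · rw [Equiv.swap_apply_of_ne_of_ne hki hkj]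

/-- Swapping two entries on the same side of `S` stays in the face and moves by a multiple of this
vector, nonzero since `α` is injective. -/
theorem single_sub_single_mem_vectorSpan (hα : StrictMono α) {S : Finset (Fin (d + 1))}
    {i j : Fin (d + 1)} (hij : i ∈ S ↔ j ∈ S) :
    (Pi.single i 1 - Pi.single j 1 : Fin (d + 1) → ℝ) ∈ vectorSpan ℝ (subsetFace α S) := by
  rcases eq_or_ne i j with rfl | hne
  · simp
  obtain ⟨π, hπ⟩ := exists_perm_mem_subsetFace hα S
  have h := vsub_mem_vectorSpan ℝ hπ (swap_mem_subsetFace hα hπ hij)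
  have hc : α (π i) - α (π j) ≠ 0 := sub_ne_zero.2 (hα.injective.ne (π.injective.ne hne))
  have heq : (fun k => α (π k)) -ᵥ (fun k => α (((Equiv.swap i j).trans π) k)) =
      (α (π i) - α (π j)) • (Pi.single i 1 - Pi.single j 1 : Fin (d + 1) → ℝ) := by
    ext k
    simp only [vsub_eq_sub, Pi.sub_apply, Equiv.trans_apply, Pi.smul_apply, smul_eq_mul]
    rcases eq_or_ne k i with rfl | hki
    · simp [hne]
    rcases eq_or_ne k j with rfl | hkj
    · simp [hki]
    · simp [Equiv.swap_apply_of_ne_of_ne hki hkj, hki, hkj]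
  rw [heq] at h
  exact (Submodule.smul_mem_iff _ hc).1 h

/-- A vector in both kernels sums to zero on `S` and on `Sᶜ`, so on each block it combines
differences of unit vectors from that block. -/
theorem vectorSpan_subsetFace (hα : StrictMono α) (S : Finset (Fin (d + 1))) :
    vectorSpan ℝ (subsetFace α S) =
      LinearMap.ker (sumOn (Finset.univ : Finset (Fin (d + 1)))) ⊓ LinearMap.ker (sumOn S) := by
  apply le_antisymm
  · rw [vectorSpan, Submodule.span_le]
    rintro _ ⟨x, hx, y, hy, rfl⟩
    have hxU := ((mem_permutohedron_iff hα).1 hx.1).1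
    have hyU := ((mem_permutohedron_iff hα).1 hy.1).1
    constructor
    · change sumOn _ (x - y) = 0
      rw [map_sub, sumOn_apply, sumOn_apply, sub_eq_zero]
      exact Eq.trans hxU (Eq.symm hyU)
    · change sumOn _ (x - y) = 0
      rw [map_sub, sumOn_apply, sumOn_apply, hx.2, hy.2, sub_self]
  · rintro v ⟨hv, hvS⟩
    change sumOn _ v = 0 at hv hvS
    rw [sumOn_apply] at hv hvS
    have hvc : ∑ i ∈ Sᶜ, v i = 0 := by
      have := Finset.sum_add_sum_compl S v
      linarith
    -- A base point of the block; `0` is a dummy for the empty block.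
    have hrep : ∀ A : Finset (Fin (d + 1)), ∃ s, ∀ i ∈ A, s ∈ A := fun A => by
      rcases A.eq_empty_or_nonempty with rfl | ⟨s, hs⟩
      · exact ⟨0, by simp⟩
      · exact ⟨s, fun _ _ => hs⟩
    have hblock : ∀ A : Finset (Fin (d + 1)), (∀ i ∈ A, ∀ j ∈ A, (i ∈ S ↔ j ∈ S)) →
        ∑ i ∈ A, v i = 0 →
        ∑ i ∈ A, v i • (Pi.single i 1 : Fin (d + 1) → ℝ) ∈ vectorSpan ℝ (subsetFace α S) := by
      intro A hA hsum
      obtain ⟨s, hs⟩ := hrep A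
      have : ∑ i ∈ A, v i • (Pi.single i 1 : Fin (d + 1) → ℝ) =
          ∑ i ∈ A, v i • (Pi.single i 1 - Pi.single s 1 : Fin (d + 1) → ℝ) := by
        simp only [smul_sub, Finset.sum_sub_distrib]
        rw [← Finset.sum_smul, hsum, zero_smul, sub_zero]
      rw [this]
      exact Submodule.sum_mem _ fun i hi => Submodule.smul_mem _ _
        (single_sub_single_mem_vectorSpan hα (hA i hi s (hs i hi)))
    rw [pi_eq_sum_univ' v, ← Finset.sum_add_sum_compl S]
    refine Submodule.add_mem _ (hblock S (fun i hi j hj => by simp [hi, hj]) hvS)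
      (hblock Sᶜ (fun i hi j hj => ?_) hvc)
    rw [Finset.mem_compl] at hi hj
    simp [hi, hj]

/-- With `s ∈ S` and `t ∉ S`, `sumOn S` is nonzero on `Pi.single s 1 - Pi.single t 1`, so its kernel
cuts the direction of the permutohedron by one dimension. -/
theorem dimension_subsetFace (hα : StrictMono α) {S : Finset (Fin (d + 1))} (hS : S.Nonempty)
    (hS' : S ≠ Finset.univ) :
    dimension (subsetFace α S) + 1 = dimension (permutohedron α) := by
  rw [← subsetFace_univ hα, dimension, dimension, direction_affineSpan, direction_affineSpan,
    vectorSpan_subsetFace hα, vectorSpan_subsetFace hα, inf_idem]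
  set Z := LinearMap.ker (sumOn (Finset.univ : Finset (Fin (d + 1))))
  obtain ⟨s, hs⟩ := hS
  obtain ⟨t, ht⟩ : ∃ t, t ∉ S := by
    by_contra! h
    exact hS' (Finset.eq_univ_iff_forall.2 h)
  have hne : (sumOn S).comp Z.subtype ≠ 0 := by
    intro h
    have hst : (Pi.single s 1 - Pi.single t 1 : Fin (d + 1) → ℝ) ∈ Z := by
      change sumOn _ _ = 0
      simp
    have := LinearMap.congr_fun h ⟨_, hst⟩
    simp [Finset.sum_pi_single', hs, ht] at this
  have := Module.Dual.finrank_ker_add_one_of_ne_zero hne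
  rw [LinearMap.ker_comp, ← Submodule.finrank_map_subtype_eq, Submodule.map_comap_subtype] at this
  exact this

/-- The inequality `∑ i ∈ S, x i ≥ α_1 + ⋯ + α_{|S|}`, in the form `⟨a, x⟩ ≤ b`. -/
noncomputable def subsetIneq (α : Fin (d + 1) → ℝ) (S : Finset (Fin (d + 1))) :
    (Fin (d + 1) → ℝ) × ℝ :=
  (fun i => if i ∈ S then -1 else 0, -prefixSum α S.card)

theorem subsetIneq_dotProduct (S : Finset (Fin (d + 1))) (x : Fin (d + 1) → ℝ) :
    (subsetIneq α S).1 ⬝ᵥ x = -∑ i ∈ S, x i := by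
  simp [subsetIneq, dotProduct, Finset.sum_ite_mem]

theorem subsetFace_eq (S : Finset (Fin (d + 1))) :
    {x | x ∈ permutohedron α ∧ (subsetIneq α S).1 ⬝ᵥ x = (subsetIneq α S).2} =
      subsetFace α S := by
  ext x
  simp only [Set.mem_ofPred_eq, subsetIneq_dotProduct, subsetFace]
  rw [subsetIneq, neg_inj]

theorem isFacet_subsetFace (hα : StrictMono α) {S : Finset (Fin (d + 1))} (hS : S.Nonempty)
    (hS' : S ≠ Finset.univ) : IsFacet (permutohedron α) (subsetFace α S) := by
  obtain ⟨π, hπ⟩ := exists_perm_mem_subsetFace hα S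
  refine ⟨⟨_, hπ⟩, ⟨(subsetIneq α S).1, ?_⟩, dimension_subsetFace hα hS hS'⟩
  ext x
  refine and_congr_right fun hx => ?_
  simp only [subsetIneq_dotProduct, neg_le_neg_iff]
  constructor
  · intro h y hy
    rw [h]
    exact ((mem_permutohedron_iff hα).1 hy).2 S
  · intro h
    exact le_antisymm ((h _ hπ.1).trans_eq hπ.2) (((mem_permutohedron_iff hα).1 hx).2 S)

/-- At a common vertex `T ⊆ S`. Swapping `i ∈ T` with `j ∈ S` stays in the face of `S`, hence in
that of `T`, which forces `j ∈ T`. -/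
theorem subset_of_subsetFace_eq (hα : StrictMono α) {S T : Finset (Fin (d + 1))}
    (hT : T.Nonempty) (h : subsetFace α S = subsetFace α T) (hcard : T.card ≤ S.card) :
    S = T := by
  obtain ⟨π, hπ⟩ := exists_perm_mem_subsetFace hα S
  have hS' := (perm_mem_subsetFace_iff hα π S).1 hπ
  have hT' := (perm_mem_subsetFace_iff hα π T).1 (h ▸ hπ)
  have hTS : T ⊆ S := fun i hi => (hS' i).2 (((hT' i).1 hi).trans_le hcard)
  refine (hTS.antisymm fun j hj => ?_).symm
  obtain ⟨i, hi⟩ := hT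
  have hsw := swap_mem_subsetFace hα hπ (iff_of_true (hTS hi) hj)
  rw [h, perm_mem_subsetFace_iff hα] at hsw
  have := (hsw i).1 hi
  rwa [Equiv.trans_apply, Equiv.swap_apply_left, ← hT'] at this

theorem subsetFace_injective (hα : StrictMono α) {S T : Finset (Fin (d + 1))}
    (hS : S.Nonempty) (hT : T.Nonempty) (h : subsetFace α S = subsetFace α T) : S = T := by
  rcases le_total T.card S.card with hc | hc
  · exact subset_of_subsetFace_eq hα hT h hc
  · exact (subset_of_subsetFace_eq hα hS h.symm hc).symm

/-- A face on which a nonconstant weight is greatest lies in the face of the set of positions where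
the weight is least. -/
theorem exists_subset_subsetFace (hα : StrictMono α) {w : Fin (d + 1) → ℝ}
    (hw : ∃ i j, w i ≠ w j) :
    ∃ S : Finset (Fin (d + 1)), S.Nonempty ∧ S ≠ Finset.univ ∧
      {x | x ∈ permutohedron α ∧ ∀ y ∈ permutohedron α, w ⬝ᵥ y ≤ w ⬝ᵥ x} ⊆ subsetFace α S := by
  obtain ⟨m, -, hm⟩ := Finset.exists_min_image Finset.univ w Finset.univ_nonempty
  replace hm := fun i => hm i (Finset.mem_univ i)
  set S : Finset (Fin (d + 1)) := {i | w i = w m} with hSdef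
  have hmem : ∀ i, i ∈ S ↔ w i = w m := by simp [hSdef]
  have hne : Sᶜ.Nonempty := by
    obtain ⟨i, j, hij⟩ := hw
    by_contra h
    rw [Finset.not_nonempty_iff_eq_empty, Finset.compl_eq_empty_iff, Finset.eq_univ_iff_forall] at h
    exact hij (((hmem i).1 (h i)).trans ((hmem j).1 (h j)).symm)
  -- `δ` will be the gap between the least and second least values of `w`.
  obtain ⟨k, hk, hmin⟩ := Finset.exists_min_image Sᶜ w hne
  rw [Finset.mem_compl, hmem] at hk
  set δ := w k - w m
  have hδ : 0 < δ := sub_pos.2 (lt_of_le_of_ne (hm k) (Ne.symm hk))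
  refine ⟨S, ⟨m, (hmem m).2 rfl⟩, fun h => by simp [h] at hne, ?_⟩
  rintro x ⟨hxP, hx⟩
  refine ⟨hxP, ?_⟩
  obtain ⟨hxU, hxS⟩ := (mem_permutohedron_iff hα).1 hxP
  set σ := Tuple.sort w
  have hσ : Monotone (w ∘ σ) := Tuple.monotone_sort w
  have hp := perm_mem_permutohedron α σ.symm
  set p : Fin (d + 1) → ℝ := fun i => α (σ.symm i)
  have hwx : w ⬝ᵥ p ≤ w ⬝ᵥ x := hx p hp
  have hstep : ∀ i j, w i ≤ w j → j ∈ S → i ∈ S := fun i j hij hj => by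
    rw [hmem] at hj ⊢
    exact le_antisymm (hij.trans hj.le) (hm i)
  have hcompl : ∀ i, i ∉ S → w m + δ ≤ w i := fun i hi => by
    have := hmin i (Finset.mem_compl.2 hi)
    simp only [δ]
    linarith
  let u : Fin (d + 1) → ℝ := fun i => if i ∈ S then -1 else 0
  have hdot : ∀ y, u ⬝ᵥ y = -∑ i ∈ S, y i := subsetIneq_dotProduct (α := α) S
  have hu : Monotone (u ∘ σ) := fun a b hab => by
    have := hstep _ _ (hσ hab)
    simp only [Function.comp_apply, u]
    split_ifs with ha hb hb
    · exact le_rfl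
    · norm_num
    · exact absurd (this hb) ha
    · exact le_rfl
  -- Subtracting `δ • u` raises `w` by `δ` on `S`, only up to the second least value, so `σ` still
  -- sorts it and `p` maximizes this weight too.
  have hwu : Monotone ((w - δ • u) ∘ σ) := fun a b hab => by
    have h1 := hstep _ _ (hσ hab)
    have h2 : w (σ a) ≤ w (σ b) := hσ hab
    simp only [Function.comp_apply, Pi.sub_apply, Pi.smul_apply, u, smul_eq_mul]
    split_ifs with ha hb hb
    · linarith
    · have h3 := hcompl _ hb
      rw [hmem] at ha
      linarith
    · exact absurd (h1 hb) ha
    · linarith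
  have h1 := dotProduct_le_of_monotone_comp hwu hxU hxS
  rw [sub_dotProduct, sub_dotProduct, smul_dotProduct, smul_dotProduct, hdot, hdot, smul_eq_mul,
    smul_eq_mul] at h1
  have h2 : ∑ i ∈ S, p i ≤ prefixSum α S.card := by
    obtain ⟨π, hπ, hπS⟩ := exists_perm_mem_subsetFace hα S
    obtain ⟨hπU, hπS'⟩ := (mem_permutohedron_iff hα).1 hπ
    have h3 := dotProduct_le_of_monotone_comp hu hπU hπS'
    rw [hdot, hdot, hπS] at h3
    exact neg_le_neg_iff.1 h3
  -- `p` is optimal for `w - δ • u` while `x` is at least as good for `w`, so `x` is at least as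
  -- good for `u`.
  have h3 : ∑ i ∈ S, x i ≤ ∑ i ∈ S, p i := by
    refine le_of_mul_le_mul_left ?_ hδ
    linarith
  exact le_antisymm (h3.trans h2) (hxS S)

/-- A facet lies in some `subsetFace α S` of equal dimension, so their directions agree. Its weight
vanishes on that direction, is thus constant on `subsetFace α S`, and the two faces coincide. A
constant weight would give the whole polytope. -/
theorem exists_eq_subsetFace_of_isFacet (hα : StrictMono α) {F : Set (Fin (d + 1) → ℝ)}
    (hF : IsFacet (permutohedron α) F) :
    ∃ S : Finset (Fin (d + 1)), S.Nonempty ∧ S ≠ Finset.univ ∧ subsetFace α S = F := by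
  obtain ⟨⟨x₀, hx₀⟩, ⟨w, hw⟩, hdim⟩ := hF
  by_cases hconst : ∃ i j, w i ≠ w j
  · obtain ⟨S, hS, hS', hsub⟩ := exists_subset_subsetFace hα hconst
    rw [← hw] at hsub
    refine ⟨S, hS, hS', Set.Subset.antisymm (fun x hx => ?_) hsub⟩
    have hspan : vectorSpan ℝ F = vectorSpan ℝ (subsetFace α S) := by
      refine Submodule.eq_of_le_of_finrank_eq (vectorSpan_mono ℝ hsub) ?_
      have h : dimension F = dimension (subsetFace α S) := by
        have := dimension_subsetFace hα hS hS'
        omega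
      rwa [dimension, dimension, direction_affineSpan, direction_affineSpan] at h
    have hker : vectorSpan ℝ F ≤ LinearMap.ker (Fintype.linearCombination ℝ w) := by
      rw [vectorSpan, Submodule.span_le]
      rintro _ ⟨y, hy, z, hz, rfl⟩
      rw [hw] at hy hz
      have h : w ⬝ᵥ (y - z) = 0 := by
        rw [dotProduct_sub, sub_eq_zero]
        exact le_antisymm (hz.2 y hy.1) (hy.2 z hz.1)
      change Fintype.linearCombination ℝ w (y - z) = 0
      rw [← h, Fintype.linearCombination_apply, dotProduct]
      exact Finset.sum_congr rfl fun i _ => by rw [smul_eq_mul, mul_comm]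
    have hmem := hker (hspan ▸ vsub_mem_vectorSpan ℝ hx (hsub hx₀))
    have hdot : w ⬝ᵥ x = w ⬝ᵥ x₀ := by
      rw [LinearMap.mem_ker, vsub_eq_sub, map_sub, sub_eq_zero, Fintype.linearCombination_apply,
        Fintype.linearCombination_apply] at hmem
      simpa [dotProduct, mul_comm] using hmem
    rw [hw] at hx₀ ⊢
    exact ⟨hx.1, fun y hy => (hx₀.2 y hy).trans_eq hdot.symm⟩
  · push Not at hconst
    exfalso
    have hval : ∀ y ∈ permutohedron α, w ⬝ᵥ y = w 0 * ∑ i, α i := fun y hy => by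
      rw [← show ∑ i, y i = ∑ i, α i from ((mem_permutohedron_iff hα).1 hy).1, Finset.mul_sum]
      exact Finset.sum_congr rfl fun i _ => by rw [hconst i 0]
    have : F = permutohedron α := by
      rw [hw]
      ext x
      exact and_iff_left_of_imp fun hx y hy => by rw [hval x hx, hval y hy]
    rw [this] at hdim
    omega

open Classical in
/-- The inequalities of the nonempty proper subsets with property `p`. -/
noncomputable def subsetSystem (α : Fin (d + 1) → ℝ) (p : Finset (Fin (d + 1)) → Prop) :
    Finset ((Fin (d + 1) → ℝ) × ℝ) :=
  ({S | (S.Nonempty ∧ S ≠ Finset.univ) ∧ p S} : Finset (Finset (Fin (d + 1)))).image (subsetIneq α)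

theorem mem_subsetSystem {p : Finset (Fin (d + 1)) → Prop} {q : (Fin (d + 1) → ℝ) × ℝ} :
    q ∈ subsetSystem α p ↔ ∃ S, ((S.Nonempty ∧ S ≠ Finset.univ) ∧ p S) ∧ subsetIneq α S = q := by
  simp [subsetSystem]

/-- Leaving out `∅` and `Finset.univ` loses nothing: in `affU α` their inequalities are equalities.
-/
theorem mem_solutionSet_subsetSystem {p : Finset (Fin (d + 1)) → Prop} {x : Fin (d + 1) → ℝ} :
    x ∈ solutionSet (affU α) (subsetSystem α p) ↔
      x ∈ affU α ∧ ∀ S, p S → prefixSum α S.card ≤ ∑ i ∈ S, x i := by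
  refine and_congr_right fun hU => ⟨fun h S hS => ?_, fun h q hq => ?_⟩
  · rcases S.eq_empty_or_nonempty with rfl | hne
    · simp
    by_cases huniv : S = Finset.univ
    · rw [huniv, Finset.card_univ, Fintype.card_fin, prefixSum_top]
      exact (Eq.symm hU).le
    · have := h _ (mem_subsetSystem.2 ⟨S, ⟨⟨hne, huniv⟩, hS⟩, rfl⟩)
      rw [subsetIneq_dotProduct] at this
      exact neg_le_neg_iff.1 this
  · obtain ⟨S, ⟨-, hS⟩, rfl⟩ := mem_subsetSystem.1 hq
    rw [subsetIneq_dotProduct]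
    exact neg_le_neg (h S hS)

theorem isMinimalDescription_permutohedron (hα : StrictMono α) :
    IsMinimalDescription (affU α) (permutohedron α) (subsetSystem α fun _ => True) := by
  refine ⟨?_, ?_, ?_, ?_⟩
  · ext x
    rw [mem_solutionSet_subsetSystem, mem_permutohedron_iff hα]
    simp
  · intro q hq
    obtain ⟨S, ⟨⟨hS, hS'⟩, -⟩, rfl⟩ := mem_subsetSystem.1 hq
    simp only [subsetFace_eq]
    exact isFacet_subsetFace hα hS hS'
  · intro q hq q' hq' h
    obtain ⟨S, ⟨⟨hS, -⟩, -⟩, rfl⟩ := mem_subsetSystem.1 hq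
    obtain ⟨T, ⟨⟨hT, -⟩, -⟩, rfl⟩ := mem_subsetSystem.1 hq'
    simp only [subsetFace_eq] at h
    rw [subsetFace_injective hα hS hT h]
  · intro F hF
    obtain ⟨S, hS, hS', rfl⟩ := exists_eq_subsetFace_of_isFacet hα hF
    exact ⟨subsetIneq α S, mem_subsetSystem.2 ⟨S, ⟨⟨hS, hS'⟩, trivial⟩, rfl⟩, subsetFace_eq S⟩

end Facets

theorem isBounded_lodAsso {d : ℕ} (α : Fin (d + 1) → ℝ) : Bornology.IsBounded (lodAsso α) :=
  (Set.Finite.isCompact_convexHull ℝ (finite_lodayVertices α)).isBounded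

end LodayAssociahedron

theorem corollary4p12 {d : ℕ} (α : Fin (d + 1) → ℝ) (hα : StrictMono α) :
    LodayAssociahedron.IsRemovohedron α (LodayAssociahedron.lodAsso α) := by
  open LodayAssociahedron in
  refine ⟨isBounded_lodAsso α, subsetSystem α fun _ => True, subsetSystem α fun S =>
    ∃ p q, p ≤ q ∧ q ≤ d + 1 ∧ S = labelInterval d p q,
    isMinimalDescription_permutohedron hα, fun r hr => ?_, ?_⟩
  · obtain ⟨S, ⟨hS, -⟩, rfl⟩ := mem_subsetSystem.1 hr
    exact mem_subsetSystem.2 ⟨S, ⟨hS, trivial⟩, rfl⟩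
  · ext x
    rw [mem_solutionSet_subsetSystem, mem_lodAsso_iff hα.monotone]
    refine and_congr_right fun _ => ⟨?_, fun h p q hpq hq => h _ ⟨p, q, hpq, hq, rfl⟩⟩
    rintro h _ ⟨p, q, hpq, hq, rfl⟩
    exact h p q hpq hq
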